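/- \textbf{Theorem.} (i) There exists a universal constant $\delta>0$ such that the following holds for all sufficiently large $n\in\mathbb{N}$. Let $\mathcal{H}$ be the collection of all graphs on the vertex set $[n]$, write $e(H)$ for the number of edges of $H$, and let $a:\mathcal{H}\to\mathbb{R}_{\ge 0}$ satisfy \[\sum_{H\in\mathcal{H}} a(H)\exp\left(-\frac{\delta\, e(H)}{\sqrt n}\right)<\frac12 .\] Then there is a triangle-free graph $G$ on $[n]$ such that \[\sum_{H\in\mathcal{H}:\ E(G)\cap E(H)=\emptyset} a(H)<1 .\] (ii) Equivalently, $q_f(\mathcal{T}_n)=\Omega(1/\sqrt n)$: there is a constant $c>0$ such that $q_f(\mathcal{T}_n)\ge c/\sqrt n$ for all sufficiently large $n$. Here $\mathcal{T}_n$ is the down-set of (edge sets of) triangle-free graphs on $[n]$ in $2^X$, where $X=\binom{[n]}{2}$, and, for a down-set $\mathcal{F}\subsetneq 2^X$ with $X$ finite, $q_f(\mathcal{F})$ is the fractional expectation-threshold of $\mathcal{F}$, i.e. the smallest $p\in[0,1]$ for which there is a function $g:2^X\to\mathbb{R}_{\ge0}$ with $\sum_{T\supseteq S} g(T)\ge 1$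 for every $S\in\mathcal{F}$ and $\sum_{T\subseteq X} g(T)(1-p)^{|X\setminus T|}\le \frac12$. -/

import Mathlib

/-- A down-set `F` of subsets of a finite set `X` is weakly `p`-small if there is a fractional
certificate `g : 2^X → ℝ≥0` with `∑_{T ⊇ S} g(T) ≥ 1` for every `S ∈ F` and
`∑_T g(T) (1 - p)^{|X \ T|} ≤ 1/2`. -/
def WeaklySmall {X : Type*} [Fintype X] [DecidableEq X] (F : Set (Finset X)) (p : ℝ) : Prop :=
  ∃ g : Finset X → ℝ, (∀ T, 0 ≤ g T) ∧
    (∀ S ∈ F, 1 ≤ ∑ T : Finset X with S ⊆ T, g T) ∧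
    ∑ T : Finset X, g T * (1 - p) ^ (Tᶜ).card ≤ 1 / 2

/-- The fractional expectation-threshold `q_f(F)` of a down-set `F`: the smallest `p ∈ [0,1]`
for which `F` is weakly `p`-small.  The minimum exists when `F` is not all of `2^X`,
see `isLeast_fracExpThreshold`. -/
noncomputable def fracExpThreshold {X : Type*} [Fintype X] [DecidableEq X]
    (F : Set (Finset X)) : ℝ :=
  sInf {p : ℝ | p ∈ Set.Icc (0 : ℝ) 1 ∧ WeaklySmall F p}

theorem isLeast_fracExpThreshold {X : Type*} [Fintype X] [DecidableEq X]
    (F : Set (Finset X)) (hF : Finset.univ ∉ F) :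
    IsLeast {p : ℝ | p ∈ Set.Icc (0 : ℝ) 1 ∧ WeaklySmall F p} (fracExpThreshold F) := by
  set K : Set (ℝ × (Finset X → ℝ)) :=
    (Set.Icc (0 : ℝ) 1 ×ˢ Set.Icc (0 : Finset X → ℝ) 1) ∩
      ({x | ∀ S ∈ F, 1 ≤ ∑ T : Finset X with S ⊆ T, x.2 T} ∩
        {x | ∑ T : Finset X, x.2 T * (1 - x.1) ^ (Tᶜ).card ≤ 1 / 2}) with hK
  have hcomp : IsCompact K := by
    refine (isCompact_Icc.prod isCompact_Icc).inter_right (IsClosed.inter ?_ ?_)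
    · simp only [Set.ofPred_forall]
      exact isClosed_iInter fun S => isClosed_iInter fun _ =>
        isClosed_le (by fun_prop) (by fun_prop)
    · exact isClosed_le (by fun_prop) (by fun_prop)
  have himg : {p : ℝ | p ∈ Set.Icc (0 : ℝ) 1 ∧ WeaklySmall F p} = Prod.fst '' K := by
    ext p
    constructor
    · rintro ⟨hp, g, hg0, hg1, hg2⟩
      refine ⟨(p, fun T => min (g T) 1), ⟨⟨hp, ?_, ?_⟩, ?_, ?_⟩, rfl⟩
      · intro T; exact le_min (hg0 T) zero_le_one
      · intro T; exact min_le_right _ _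
      · intro S hS
        by_cases h : ∃ T, S ⊆ T ∧ 1 ≤ g T
        · obtain ⟨T, hT, h1⟩ := h
          calc (1 : ℝ) = min (g T) 1 := (min_eq_right h1).symm
            _ ≤ _ := Finset.single_le_sum (f := fun T => min (g T) 1)
              (fun T _ => le_min (hg0 T) zero_le_one) (by simpa using hT)
        · push Not at h
          refine (hg1 S hS).trans (le_of_eq (Finset.sum_congr rfl fun T hT => ?_))
          exact (min_eq_left (h T (by simpa using hT)).le).symm
      · refine le_trans (Finset.sum_le_sum fun T _ => ?_) hg2
        exact mul_le_mul_of_nonneg_right (min_le_left _ _)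
          (pow_nonneg (by linarith [hp.2]) _)
    · rintro ⟨⟨q, g⟩, ⟨⟨hp, hg0, _⟩, hg1, hg2⟩, rfl⟩
      exact ⟨hp, g, hg0, hg1, hg2⟩
  have hne : {p : ℝ | p ∈ Set.Icc (0 : ℝ) 1 ∧ WeaklySmall F p}.Nonempty := by
    refine ⟨1, by simp, fun T => if T = Finset.univ then 0 else 1, ?_, ?_, ?_⟩
    · intro T; dsimp only; split_ifs <;> norm_num
    · intro S hS
      have hSu : S ≠ Finset.univ := fun h => hF (h ▸ hS)
      calc (1 : ℝ) = if S = Finset.univ then 0 else 1 := by simp [hSu]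
        _ ≤ _ := Finset.single_le_sum
          (f := fun T : Finset X => if T = Finset.univ then (0 : ℝ) else 1)
          (fun T _ => by split_ifs <;> norm_num) (by simp)
    · rw [Finset.sum_eq_zero]
      · norm_num
      · intro T _
        by_cases hT : T = Finset.univ
        · simp [hT]
        · simp [hT, Finset.card_eq_zero]
  have hc : IsCompact {p : ℝ | p ∈ Set.Icc (0 : ℝ) 1 ∧ WeaklySmall F p} :=
    himg ▸ hcomp.image continuous_fst
  exact hc.isLeast_sInf hne

/-- The family `T_n` of triangle-free graphs on `[n]`, a graph being identified with its edge set,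
which is a subset of the set of edges of the complete graph on `[n]`. -/
def triangleFreeFamily (n : ℕ) : Set (Finset (⊤ : SimpleGraph (Fin n)).edgeSet) :=
  {S | (SimpleGraph.fromEdgeSet
    ((fun e : (⊤ : SimpleGraph (Fin n)).edgeSet => (e : Sym2 (Fin n))) '' (S : Set _))).CliqueFree 3}

theorem triangleFreeFamily_isLowerSet (n : ℕ) : IsLowerSet (triangleFreeFamily n) := by
  intro S T hTS hS
  exact SimpleGraph.CliqueFree.anti
    (SimpleGraph.fromEdgeSet_mono (Set.image_mono (Finset.coe_subset.mpr hTS))) hS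

theorem univ_notMem_triangleFreeFamily {n : ℕ} (hn : 3 ≤ n) :
    Finset.univ ∉ triangleFreeFamily n := by
  intro h
  have h' : (⊤ : SimpleGraph (Fin n)).CliqueFree 3 := by
    refine SimpleGraph.CliqueFree.anti (fun u v huv => ?_) h
    rw [SimpleGraph.fromEdgeSet_adj]
    exact ⟨⟨⟨s(u, v), huv⟩, by simp, rfl⟩, huv.ne⟩
  exact SimpleGraph.IsContained.not_cliqueFree
    ⟨(SimpleGraph.Embedding.completeGraph (Fin.castLEEmb hn)).toCopy⟩ h'

open Classical in
/-- The collection of all graphs `H` on `[n]` with `G ∩ H = ∅`, that is, sharing no edge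
with `G`. -/
noncomputable def edgeDisjointGraphs {n : ℕ} (G : SimpleGraph (Fin n)) :
    Finset (SimpleGraph (Fin n)) :=
  Finset.univ.filter fun H => G.edgeSet ∩ H.edgeSet = ∅

/-! Take a random graph `S` with edge probability `p = 1 / (10√n)` and delete every edge of a
maximal family of edge-disjoint triangles in `S`; by maximality what remains is triangle-free. Fix
`H` and put `m = p * e(H)`. If the remainder misses `H`, every edge of `S ∩ H` was deleted. So
either `S ∩ H` has at most `m / 2` edges, half its mean, or at least about `m / 6` edge-disjoint
triangles of `S` meet `H`. The first event is a binomial lower tail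
(`sum_bernoulliWeight_card_inter_le`). The second is a union bound over packings
(`sum_bernoulliWeight_exists_packing_le`): at most `e(H) * n` triangles meet `H`, so their expected
number in `S` is at most `m / 100`. Each probability is at most `exp (-m / 10)`, and averaging over
`S` gives a good graph. Only the degree bound `D = n` is special to triangles, so the argument is
run for families of triples. -/

/-! ### Random subsets of a finite set -/

section RandomSubset

variable {X : Type*} [Fintype X] [DecidableEq X]

/-- The probability that a `p`-random subset of `X` equals `S`. -/
def bernoulliWeight (p : ℝ) (S : Finset X) : ℝ :=
  (∏ _i ∈ S, p) * ∏ _i ∈ Finset.univ \ S, (1 - p)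

theorem bernoulliWeight_nonneg {p : ℝ} (h0 : 0 ≤ p) (h1 : p ≤ 1) (S : Finset X) :
    0 ≤ bernoulliWeight p S :=
  mul_nonneg (Finset.prod_nonneg fun _ _ => h0) (Finset.prod_nonneg fun _ _ => sub_nonneg.2 h1)

theorem sum_bernoulliWeight (p : ℝ) : ∑ S : Finset X, bernoulliWeight p S = 1 := by
  have h := Finset.prod_add (fun _ : X => p) (fun _ => 1 - p) Finset.univ
  rw [Finset.powerset_univ] at h
  exact h.symm.trans (by simp)

theorem sum_bernoulliWeight_superset_le {p : ℝ} (h0 : 0 ≤ p) (h1 : p ≤ 1) (T : Finset X) :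
    ∑ S : Finset X with T ⊆ S, bernoulliWeight p S ≤ p ^ T.card := by
  have h := Finset.prod_add (fun _ : X => p) (fun i => if i ∈ T then 0 else 1 - p) Finset.univ
  rw [Finset.powerset_univ] at h
  have hT : ∏ i : X, (p + if i ∈ T then 0 else 1 - p) = p ^ T.card := by
    have : ∀ i : X, (p + if i ∈ T then 0 else 1 - p) = if i ∈ T then p else 1 := by
      intro i; split_ifs <;> ring
    simp_rw [this]
    simp
  rw [← hT, h]
  have hg : ∀ i : X, 0 ≤ if i ∈ T then 0 else 1 - p := fun i => by split_ifs <;> linarith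
  refine (Finset.sum_le_sum fun S hS => le_of_eq ?_).trans
    (Finset.sum_le_sum_of_subset_of_nonneg (Finset.filter_subset _ _) fun S _ _ =>
      mul_nonneg (Finset.prod_nonneg fun _ _ => h0) (Finset.prod_nonneg fun i _ => hg i))
  rw [bernoulliWeight]
  congr 1
  refine Finset.prod_congr rfl fun i hi => ?_
  rw [if_neg fun hiT => (Finset.mem_sdiff.1 hi).2 ((Finset.mem_filter.1 hS).2 hiT)]

theorem sum_bernoulliWeight_mul_pow_card_inter (p t : ℝ) (H : Finset X) :
    ∑ S : Finset X, bernoulliWeight p S * t ^ (S ∩ H).card = (1 - p + p * t) ^ H.card := by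
  have h := Finset.prod_add (fun i : X => p * if i ∈ H then t else 1) (fun _ => 1 - p) Finset.univ
  rw [Finset.powerset_univ] at h
  have hH : ∏ i : X, ((p * if i ∈ H then t else 1) + (1 - p)) = (1 - p + p * t) ^ H.card := by
    have : ∀ i : X, ((p * if i ∈ H then t else 1) + (1 - p)) =
        if i ∈ H then 1 - p + p * t else 1 := by
      intro i; split_ifs <;> ring
    simp_rw [this]
    simp
  rw [← hH, h]
  refine Finset.sum_congr rfl fun S _ => ?_
  have : ∏ i ∈ S, (if i ∈ H then t else 1) = t ^ (S ∩ H).card := by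
    rw [Finset.prod_ite_mem, Finset.prod_const]
  rw [Finset.prod_mul_distrib, this, bernoulliWeight]
  ring

/-- Lower tail of the binomial distribution. -/
theorem sum_bernoulliWeight_card_inter_le {p : ℝ} (h0 : 0 ≤ p) (h1 : p ≤ 1) (H : Finset X) :
    ∑ S : Finset X with ((S ∩ H).card : ℝ) ≤ p * H.card / 2, bernoulliWeight p S ≤
      Real.exp (-(p * H.card / 10)) := by
  -- Exponential moment at `t = exp (-1)`: since `1 - p + p * t ≤ exp (-0.6 * p)`, the exponent is
  -- `0.5 - 0.6 = -0.1` times the mean.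
  have he : Real.exp (-1) < 0.4 := by
    have := Real.exp_neg_one_lt_d9
    linarith
  calc ∑ S : Finset X with ((S ∩ H).card : ℝ) ≤ p * H.card / 2, bernoulliWeight p S
      ≤ ∑ S : Finset X with ((S ∩ H).card : ℝ) ≤ p * H.card / 2,
          Real.exp (p * H.card / 2) * (bernoulliWeight p S * Real.exp (-1) ^ (S ∩ H).card) := by
        refine Finset.sum_le_sum fun S hS => ?_
        have hS' := (Finset.mem_filter.1 hS).2
        have : 1 ≤ Real.exp (p * H.card / 2) * Real.exp (-1) ^ (S ∩ H).card := by
          rw [← Real.exp_nat_mul, ← Real.exp_add]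
          exact Real.one_le_exp (by linarith)
        nlinarith [bernoulliWeight_nonneg h0 h1 S]
    _ ≤ ∑ S : Finset X,
          Real.exp (p * H.card / 2) * (bernoulliWeight p S * Real.exp (-1) ^ (S ∩ H).card) :=
        Finset.sum_le_sum_of_subset_of_nonneg (Finset.filter_subset _ _) fun S _ _ => by
          have := bernoulliWeight_nonneg h0 h1 S
          positivity
    _ = Real.exp (p * H.card / 2) * (1 - p + p * Real.exp (-1)) ^ H.card := by
        rw [← Finset.mul_sum, sum_bernoulliWeight_mul_pow_card_inter]
    _ ≤ Real.exp (p * H.card / 2) * Real.exp (-(p * 0.6)) ^ H.card := by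
        have h2 := mul_nonneg h0 (Real.exp_pos (-1)).le
        have h3 := Real.add_one_le_exp (-(p * 0.6))
        have h4 := mul_le_mul_of_nonneg_left he.le h0
        exact mul_le_mul_of_nonneg_left (pow_le_pow_left₀ (by linarith) (by linarith) _)
          (Real.exp_pos _).le
    _ = Real.exp (-(p * H.card / 10)) := by
        rw [← Real.exp_nat_mul, ← Real.exp_add]
        congr 1
        ring

end RandomSubset

/-! ### Deleting a maximal packing from a random set -/

section Packing

variable {X : Type*} [DecidableEq X]

theorem card_filter_not_disjoint_le {𝒯 : Finset (Finset X)} {D : ℕ}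
    (hD : ∀ x, (𝒯.filter fun t => x ∈ t).card ≤ D) (H : Finset X) :
    (𝒯.filter fun t => ¬ Disjoint t H).card ≤ H.card * D := by
  refine (Finset.card_le_card (t := H.biUnion fun x => 𝒯.filter fun t => x ∈ t) ?_).trans
    (Finset.card_biUnion_le_card_mul _ _ _ fun x _ => hD x)
  intro t ht
  obtain ⟨ht, hd⟩ := Finset.mem_filter.1 ht
  obtain ⟨x, hx, hxH⟩ := Finset.not_disjoint_iff.1 hd
  exact Finset.mem_biUnion.2 ⟨x, hxH, Finset.mem_filter.2 ⟨ht, hx⟩⟩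

/-- If the complement of a packing of triples in `S` misses `H`, then either `S ∩ H` is small or
many triples of the packing meet `H`. -/
theorem card_inter_lt_or_exists_packing {S H : Finset X} {M : Finset (Finset X)}
    (hM : ∀ t ∈ M, t.card = 3) (hd : Disjoint (S \ M.biUnion id) H) (k : ℕ) :
    (S ∩ H).card + 3 ≤ 3 * k ∨ ∃ K ⊆ M.filter (fun t => ¬ Disjoint t H), K.card = k := by
  by_cases hk : k ≤ (M.filter fun t => ¬ Disjoint t H).card
  · exact Or.inr (Finset.exists_subset_card_eq hk)
  · left
    -- Each point of `S ∩ H` was deleted, so at most `k - 1` triples cover `S ∩ H`; this is the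
    -- source of the `+ 3`.
    have h1 : S ∩ H ⊆ (M.filter fun t => ¬ Disjoint t H).biUnion id := by
      intro x hx
      obtain ⟨hxS, hxH⟩ := Finset.mem_inter.1 hx
      have hxM : x ∈ M.biUnion id := by
        by_contra hxM
        exact Finset.disjoint_left.1 hd (Finset.mem_sdiff.2 ⟨hxS, hxM⟩) hxH
      obtain ⟨t, ht, hxt⟩ := Finset.mem_biUnion.1 hxM
      exact Finset.mem_biUnion.2
        ⟨t, Finset.mem_filter.2 ⟨ht, Finset.not_disjoint_iff.2 ⟨x, hxt, hxH⟩⟩, hxt⟩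
    have h2 := (Finset.card_le_card h1).trans (Finset.card_biUnion_le_card_mul _ id 3
      fun t ht => (hM t (Finset.mem_filter.1 ht).1).le)
    omega

variable [Fintype X]

/-- A member of `𝒯` surviving the deletion would be disjoint from all of `M` and could be added to a
packing of maximum size. Being nonempty, it is not already in `M`. -/
theorem exists_maximal_packing (𝒯 : Finset (Finset X)) (h𝒯 : ∀ t ∈ 𝒯, t.Nonempty)
    (S : Finset X) :
    ∃ M ⊆ 𝒯, (∀ t ∈ M, t ⊆ S) ∧ (M : Set (Finset X)).PairwiseDisjoint id ∧
      ∀ t ∈ 𝒯, ¬ t ⊆ S \ M.biUnion id := by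
  classical
  set P : Finset (Finset (Finset X)) := 𝒯.powerset.filter fun M =>
    (∀ t ∈ M, t ⊆ S) ∧ (M : Set (Finset X)).PairwiseDisjoint id with hP
  obtain ⟨M, hM, hmax⟩ := P.exists_max_image Finset.card ⟨∅, by simp [hP]⟩
  obtain ⟨hM1, hM2, hM3⟩ : M ⊆ 𝒯 ∧ (∀ t ∈ M, t ⊆ S) ∧
      (M : Set (Finset X)).PairwiseDisjoint id := by simpa [hP] using hM
  refine ⟨M, hM1, hM2, hM3, fun t ht hts => ?_⟩
  have hdisj : ∀ s ∈ M, Disjoint t s := fun s hs =>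
    (Finset.sdiff_disjoint.mono_left hts).mono_right (Finset.subset_biUnion_of_mem id hs)
  have htM : t ∉ M := fun h => (h𝒯 t ht).ne_empty (disjoint_self.1 (hdisj t h))
  have := hmax (insert t M) (by
    simp only [hP, Finset.mem_filter, Finset.mem_powerset, Finset.coe_insert]
    refine ⟨Finset.insert_subset ht hM1, ?_, hM3.insert fun s hs _ => hdisj s hs⟩
    intro s hs
    rcases Finset.mem_insert.1 hs with rfl | hs
    · exact hts.trans Finset.sdiff_subset
    · exact hM2 s hs)
  rw [Finset.card_insert_of_notMem htM] at this
  omega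

/-- The probability that a random set contains `k` disjoint members of a family of triples. -/
theorem sum_bernoulliWeight_exists_packing_le {p : ℝ} (h0 : 0 ≤ p) (h1 : p ≤ 1)
    {𝒰 : Finset (Finset X)} (h𝒰 : ∀ t ∈ 𝒰, t.card = 3) (k : ℕ) (s : Finset (Finset X))
    (hs : ∀ S ∈ s, ∃ K ⊆ 𝒰, K.card = k ∧ (K : Set (Finset X)).PairwiseDisjoint id ∧
      K.biUnion id ⊆ S) :
    ∑ S ∈ s, bernoulliWeight p S ≤ ((𝒰.card : ℝ) * p ^ 3) ^ k / k.factorial := by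
  classical
  set 𝒦 : Finset (Finset (Finset X)) := (𝒰.powersetCard k).filter fun K => (K : Set (Finset X)).PairwiseDisjoint id with h𝒦
  calc ∑ S ∈ s, bernoulliWeight p S
      ≤ ∑ S ∈ 𝒦.biUnion (fun K => Finset.univ.filter fun S => K.biUnion id ⊆ S),
          bernoulliWeight p S := by
        refine Finset.sum_le_sum_of_subset_of_nonneg (fun S hS => ?_)
          fun S _ _ => bernoulliWeight_nonneg h0 h1 S
        obtain ⟨K, hK, hk, hKd, hKS⟩ := hs S hS
        exact Finset.mem_biUnion.2 ⟨K, Finset.mem_filter.2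
          ⟨Finset.mem_powersetCard.2 ⟨hK, hk⟩, hKd⟩, by simpa using hKS⟩
    _ ≤ ∑ K ∈ 𝒦, ∑ S : Finset X with K.biUnion id ⊆ S, bernoulliWeight p S := by
        rw [← Finset.sup_eq_biUnion]
        induction 𝒦 using Finset.induction_on with
        | empty => simp
        | insert K L hK ih =>
          rw [Finset.sup_insert, Finset.sum_insert hK]
          refine le_trans ?_ (add_le_add_right ih _)
          rw [Finset.sup_eq_union, ← Finset.sum_union_inter]
          exact le_add_of_nonneg_right
            (Finset.sum_nonneg fun S _ => bernoulliWeight_nonneg h0 h1 S)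
    _ ≤ ∑ K ∈ 𝒦, (p ^ 3) ^ k := by
        refine Finset.sum_le_sum fun K hK => ?_
        obtain ⟨hK, hKd⟩ := Finset.mem_filter.1 hK
        obtain ⟨hK, hk⟩ := Finset.mem_powersetCard.1 hK
        refine (sum_bernoulliWeight_superset_le h0 h1 _).trans_eq ?_
        -- Disjointness makes the union have exactly `3 * k` points; it is then dropped when the
        -- packings are counted.
        rw [Finset.card_biUnion hKd,
          Finset.sum_congr rfl fun t ht => show (id t).card = 3 from h𝒰 t (hK ht), Finset.sum_const, hk, smul_eq_mul, mul_comm, pow_mul]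
    _ ≤ (𝒰.card.choose k : ℝ) * (p ^ 3) ^ k := by
        rw [Finset.sum_const, nsmul_eq_mul]
        gcongr
        exact (Finset.card_filter_le _ _).trans_eq (Finset.card_powersetCard _ _)
    _ ≤ (𝒰.card : ℝ) ^ k / k.factorial * (p ^ 3) ^ k := by
        gcongr
        exact Nat.choose_le_pow_div _ _
    _ = _ := by ring

/-- Bound for the probability that the random set, after deletion of a maximal packing of triples,
misses a given set `H`. -/
theorem sum_bernoulliWeight_disjoint_lt {𝒯 : Finset (Finset X)} (h𝒯 : ∀ t ∈ 𝒯, t.card = 3)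
    {D : ℕ} (hD0 : 0 < D) (hD : ∀ x, (𝒯.filter fun t => x ∈ t).card ≤ D)
    (M : Finset X → Finset (Finset X)) (hM𝒯 : ∀ S, M S ⊆ 𝒯) (hMS : ∀ S, ∀ t ∈ M S, t ⊆ S)
    (hMd : ∀ S, (M S : Set (Finset X)).PairwiseDisjoint id) (H : Finset X) :
    ∑ S : Finset X with Disjoint (S \ (M S).biUnion id) H,
        bernoulliWeight (1 / (10 * √(D : ℝ))) S <
      2 * Real.exp (-(1 / 100) * H.card / √(D : ℝ)) := by
  set p : ℝ := 1 / (10 * √(D : ℝ)) with hp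
  have hsq : 1 ≤ √(D : ℝ) := Real.one_le_sqrt.2 (by exact_mod_cast hD0)
  have hp0 : 0 < p := by positivity
  have hp1 : p ≤ 1 := by
    rw [hp, div_le_one (by positivity)]
    linarith
  have hpD : D * p ^ 2 = 1 / 100 := by
    have : √(D : ℝ) ^ 2 = D := Real.sq_sqrt (by positivity)
    rw [hp, div_pow, mul_pow, this]
    have : (D : ℝ) ≠ 0 := by positivity
    field_simp
    norm_num
  have hw := fun S : Finset X => bernoulliWeight_nonneg hp0.le hp1 S
  have hexp : -(1 / 100) * H.card / √(D : ℝ) = -(p * H.card / 10) := by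
    rw [hp]
    field_simp
    ring
  rw [hexp]
  -- For empty `H` the claim is `1 < 2`. Otherwise `m > 0`, which makes the bound on `B` strict.
  rcases H.eq_empty_or_nonempty with rfl | hH
  · simp [sum_bernoulliWeight]
  have hm : 0 < p * H.card := by
    have := hH.card_pos
    positivity
  set m := p * H.card with hm_def
  -- Rounding up gives `3 * k - 3 < m / 2`, so having fewer than `k` triples meeting `H` puts `S` in
  -- `A`.
  set k := ⌈m / 6⌉₊ with hk
  have hk1 : m / 6 ≤ k := Nat.le_ceil _
  have hk2 : (k : ℝ) < m / 6 + 1 := Nat.ceil_lt_add_one (by positivity)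
  set A : Finset (Finset X) := Finset.univ.filter fun S => ((S ∩ H).card : ℝ) ≤ m / 2
  set B : Finset (Finset X) := Finset.univ.filter fun S =>
    ∃ K ⊆ (M S).filter (fun t => ¬ Disjoint t H), K.card = k
  have hA : ∑ S ∈ A, bernoulliWeight p S ≤ Real.exp (-(m / 10)) :=
    sum_bernoulliWeight_card_inter_le hp0.le hp1 H
  have hB : ∑ S ∈ B, bernoulliWeight p S < Real.exp (-(m / 10)) := by
    have h1 := sum_bernoulliWeight_exists_packing_le hp0.le hp1
      (𝒰 := 𝒯.filter fun t => ¬ Disjoint t H) (fun t ht => h𝒯 t (Finset.mem_filter.1 ht).1) k B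
      (fun S hS => by
        obtain ⟨K, hK, hKk⟩ := (Finset.mem_filter.1 hS).2
        have hKM := hK.trans (Finset.filter_subset _ _)
        exact ⟨K, hK.trans (Finset.filter_subset_filter _ (hM𝒯 S)), hKk,
          (hMd S).subset (Finset.coe_subset.2 hKM),
          Finset.biUnion_subset.2 fun t ht => hMS S t (hKM ht)⟩)
    -- The expected number is at most `m / 100 ≤ 6 * k / 100`. As `0.06 ≤ exp (-2)`, this absorbs
    -- the factor `exp k` from `k ^ k / k!` and still leaves `exp (-k)`.
    have hcard : ((𝒯.filter fun t => ¬ Disjoint t H).card : ℝ) * p ^ 3 ≤ 0.06 * k := by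
      have : ((𝒯.filter fun t => ¬ Disjoint t H).card : ℝ) ≤ H.card * D := by
        exact_mod_cast card_filter_not_disjoint_le hD H
      calc _ ≤ (H.card * D : ℝ) * p ^ 3 := by gcongr
        _ = m * (D * p ^ 2) := by rw [hm_def]; ring
        _ ≤ _ := by rw [hpD]; linarith
    have he : 0.06 ≤ Real.exp (-2) := by
      have h3 : Real.exp 1 < 2.8 := by linarith [Real.exp_one_lt_d9]
      have : Real.exp (-2) = (Real.exp 1 ^ 2)⁻¹ := by
        rw [← Real.exp_nat_mul, ← Real.exp_neg]; norm_num
      rw [this, le_inv_comm₀ (by norm_num) (by positivity)]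
      nlinarith [Real.exp_pos 1]
    calc _ ≤ _ := h1
      _ ≤ (0.06 * k : ℝ) ^ k / k.factorial := by gcongr
      _ = 0.06 ^ k * ((k : ℝ) ^ k / k.factorial) := by rw [mul_pow, mul_div_assoc]
      _ ≤ Real.exp (-2) ^ k * Real.exp k := by
          gcongr
          exact Real.pow_div_factorial_le_exp _ (by positivity) _
      _ = Real.exp (-k) := by
          rw [← Real.exp_nat_mul, ← Real.exp_add]
          congr 1
          ring
      _ < _ := Real.exp_lt_exp.2 (by linarith)
  calc ∑ S : Finset X with Disjoint (S \ (M S).biUnion id) H, bernoulliWeight p S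
      ≤ ∑ S ∈ A ∪ B, bernoulliWeight p S := by
        refine Finset.sum_le_sum_of_subset_of_nonneg (fun S hS => ?_) fun S _ _ => hw S
        rcases card_inter_lt_or_exists_packing (fun t ht => h𝒯 t (hM𝒯 S ht))
          (Finset.mem_filter.1 hS).2 k with h | h
        · refine Finset.mem_union_left _ (Finset.mem_filter.2 ⟨Finset.mem_univ _, ?_⟩)
          have : ((S ∩ H).card : ℝ) + 3 ≤ 3 * k := by exact_mod_cast h
          linarith
        · exact Finset.mem_union_right _ (Finset.mem_filter.2 ⟨Finset.mem_univ _, h⟩)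
    _ ≤ ∑ S ∈ A, bernoulliWeight p S + ∑ S ∈ B, bernoulliWeight p S := by
        rw [← Finset.sum_union_inter]
        exact le_add_of_nonneg_right (Finset.sum_nonneg fun S _ => hw S)
    _ < _ := by linarith

/-- First-moment argument over `S`. The sum in `hsum` may equal `1 / 2`, as a certificate for
`WeaklySmall` allows; the strict inequality comes from the strict probability bound. -/
theorem exists_triple_free_sum_disjoint_lt_one {𝒯 : Finset (Finset X)}
    (h𝒯 : ∀ t ∈ 𝒯, t.card = 3) {D : ℕ} (hD0 : 0 < D)
    (hD : ∀ x, (𝒯.filter fun t => x ∈ t).card ≤ D) (b : Finset X → ℝ) (hb : ∀ H, 0 ≤ b H)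
    (hsum : ∑ H : Finset X, b H * Real.exp (-(1 / 100) * H.card / √(D : ℝ)) ≤ 1 / 2) :
    ∃ S : Finset X, (∀ t ∈ 𝒯, ¬ t ⊆ S) ∧ ∑ H : Finset X with Disjoint S H, b H < 1 := by
  choose M hM𝒯 hMS hMd hfree using exists_maximal_packing 𝒯
    fun t ht => Finset.card_pos.1 (by rw [h𝒯 t ht]; norm_num)
  set p : ℝ := 1 / (10 * √(D : ℝ)) with hp
  have hlt := sum_bernoulliWeight_disjoint_lt h𝒯 hD0 hD M hM𝒯 hMS hMd
  by_contra! hcon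
  have hone := fun S => hcon (S \ (M S).biUnion id) (hfree S)
  -- Some weight must be positive for the termwise strict bound to survive summation.
  obtain ⟨H₀, -, hH₀⟩ : ∃ H ∈ Finset.univ.filter (fun H : Finset X =>
      Disjoint (∅ \ (M ∅).biUnion id) H), 0 < b H := by
    by_contra! h
    linarith [hone ∅, Finset.sum_nonpos h]
  have hsq : 1 ≤ √(D : ℝ) := Real.one_le_sqrt.2 (by exact_mod_cast hD0)
  have hp1 : p ≤ 1 := by
    rw [hp, div_le_one (by positivity)]
    linarith
  have : (1 : ℝ) < 1 := calc
    (1 : ℝ) = ∑ S : Finset X, bernoulliWeight p S * 1 := by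
        simp_rw [mul_one, sum_bernoulliWeight]
    _ ≤ ∑ S : Finset X, bernoulliWeight p S *
          ∑ H : Finset X with Disjoint (S \ (M S).biUnion id) H, b H :=
        Finset.sum_le_sum fun S _ => mul_le_mul_of_nonneg_left (hone S)
          (bernoulliWeight_nonneg (by positivity) hp1 S)
    _ = ∑ H : Finset X, b H *
          ∑ S : Finset X with Disjoint (S \ (M S).biUnion id) H, bernoulliWeight p S := by
        simp_rw [Finset.sum_filter, Finset.mul_sum]
        rw [Finset.sum_comm]
        refine Finset.sum_congr rfl fun H _ => Finset.sum_congr rfl fun S _ => ?_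
        split_ifs <;> ring
    _ < ∑ H : Finset X, b H * (2 * Real.exp (-(1 / 100) * H.card / √(D : ℝ))) :=
        Finset.sum_lt_sum (fun H _ => mul_le_mul_of_nonneg_left (hlt H).le (hb H))
          ⟨H₀, Finset.mem_univ _, mul_lt_mul_of_pos_left (hlt H₀) hH₀⟩
    _ = 2 * ∑ H : Finset X, b H * Real.exp (-(1 / 100) * H.card / √(D : ℝ)) := by
        rw [Finset.mul_sum]
        exact Finset.sum_congr rfl fun H _ => by ring
    _ ≤ 1 := by linarith
  exact lt_irrefl _ this

end Packing

/-! ### Triangles -/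

section Triangles

open Classical in
/-- The set of edges of the complete graph on `[n]` spanned by `s`. -/
noncomputable def spannedEdges {n : ℕ} (s : Finset (Fin n)) :
    Finset (⊤ : SimpleGraph (Fin n)).edgeSet :=
  Finset.univ.filter fun e => (e : Sym2 (Fin n)) ∈ s.sym2

open Classical in
/-- The edge sets of the triangles on `[n]`. -/
noncomputable def triangles (n : ℕ) : Finset (Finset (⊤ : SimpleGraph (Fin n)).edgeSet) :=
  (Finset.powersetCard 3 Finset.univ).image spannedEdges

theorem card_spannedEdges {n : ℕ} (s : Finset (Fin n)) :
    (spannedEdges s).card = s.card.choose 2 := by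
  classical
  rw [← Finset.card_map (Function.Embedding.subtype _), ← Sym2.card_image_offDiag]
  congr 1
  ext e
  induction e using Sym2.ind with
  | _ a b =>
    simp only [spannedEdges, Finset.mem_map, Finset.mem_filter, Finset.mem_univ, true_and,
      Function.Embedding.subtype_apply, Finset.mem_image, Finset.mem_offDiag, Prod.exists]
    constructor
    · rintro ⟨⟨e, he⟩, hes, rfl⟩
      simp only [Finset.mk_mem_sym2_iff] at hes
      exact ⟨a, b, ⟨hes.1, hes.2, by simpa using he⟩, rfl⟩
    · rintro ⟨c, d, ⟨hc, hd, hcd⟩, h⟩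
      exact ⟨⟨s(a, b), by rw [← h]; simpa using hcd⟩, by simp [← h, hc, hd], rfl⟩

/-- A triangle through an edge is determined by its third vertex. -/
theorem card_filter_mem_triangles_le {n : ℕ}
    (e : (⊤ : SimpleGraph (Fin n)).edgeSet) :
    ((triangles n).filter fun t => e ∈ t).card ≤ n := by
  classical
  obtain ⟨e, he⟩ := e
  induction e using Sym2.ind with
  | _ a b =>
    have hab : a ≠ b := by simpa using he
    refine (Finset.card_le_card (t := Finset.univ.image fun c => spannedEdges {a, b, c}) ?_).trans
      (Finset.card_image_le.trans_eq (by simp))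
    intro t ht
    obtain ⟨ht, het⟩ := Finset.mem_filter.1 ht
    obtain ⟨s, hs, rfl⟩ := Finset.mem_image.1 ht
    have hs3 := (Finset.mem_powersetCard.1 hs).2
    have hmem : a ∈ s ∧ b ∈ s := by simpa [spannedEdges] using het
    have hsub : ({a, b} : Finset (Fin n)) ⊆ s := by
      simp [Finset.insert_subset_iff, hmem]
    have hc : (s \ {a, b}).card = 1 := by
      rw [Finset.card_sdiff_of_subset hsub, hs3, Finset.card_pair hab]
    obtain ⟨c, hc⟩ := Finset.card_eq_one.1 hc
    refine Finset.mem_image.2 ⟨c, Finset.mem_univ _, ?_⟩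
    congr 1
    rw [← Finset.sdiff_union_of_subset hsub, hc]
    ext x
    simp
    tauto

theorem mem_triangleFreeFamily_of_forall_not_subset {n : ℕ}
    {S : Finset (⊤ : SimpleGraph (Fin n)).edgeSet} (hS : ∀ t ∈ triangles n, ¬ t ⊆ S) :
    S ∈ triangleFreeFamily n := by
  classical
  intro s hs
  refine hS (spannedEdges s) (Finset.mem_image_of_mem _
    (Finset.mem_powersetCard.2 ⟨Finset.subset_univ _, hs.card_eq⟩)) ?_
  rintro ⟨e, he⟩ hes
  induction e using Sym2.ind with
  | _ a b =>
    have hab : a ≠ b := by simpa using he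
    have hmem : a ∈ s ∧ b ∈ s := by simpa [spannedEdges] using hes
    have := hs.isClique hmem.1 hmem.2 hab
    rw [SimpleGraph.fromEdgeSet_adj] at this
    obtain ⟨f, hf, hfe⟩ := this.1
    have : f = ⟨s(a, b), he⟩ := Subtype.ext hfe
    rw [← this]
    exact hf

theorem exists_triangleFree_sum_disjoint_lt_one {n : ℕ} (hn : 0 < n)
    (b : Finset (⊤ : SimpleGraph (Fin n)).edgeSet → ℝ) (hb : ∀ H, 0 ≤ b H)
    (hsum : ∑ H, b H * Real.exp (-(1 / 100) * H.card / √(n : ℝ)) ≤ 1 / 2) :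
    ∃ S ∈ triangleFreeFamily n,
      ∑ H : Finset (⊤ : SimpleGraph (Fin n)).edgeSet with Disjoint S H, b H < 1 := by
  classical
  obtain ⟨S, hS, h⟩ := exists_triple_free_sum_disjoint_lt_one (𝒯 := triangles n)
    (fun t ht => by
      obtain ⟨s, hs, rfl⟩ := Finset.mem_image.1 ht
      rw [card_spannedEdges, (Finset.mem_powersetCard.1 hs).2]
      rfl) hn card_filter_mem_triangles_le b hb hsum
  exact ⟨S, mem_triangleFreeFamily_of_forall_not_subset hS, h⟩

/-- Graphs on `[n]` correspond to sets of edges of the complete graph. -/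
noncomputable def graphEquivEdgeFinset (n : ℕ) :
    Finset (⊤ : SimpleGraph (Fin n)).edgeSet ≃ SimpleGraph (Fin n) where
  toFun S := SimpleGraph.fromEdgeSet
    ((fun e : (⊤ : SimpleGraph (Fin n)).edgeSet => (e : Sym2 (Fin n))) '' (S : Set _))
  invFun H := by
    classical exact Finset.univ.filter fun e => (e : Sym2 (Fin n)) ∈ H.edgeSet
  left_inv S := by
    ext ⟨e, he⟩
    have : ¬ e.IsDiag := SimpleGraph.not_isDiag_of_mem_edgeSet _ he
    simp [SimpleGraph.edgeSet_fromEdgeSet, this]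
  right_inv H := by
    ext a b
    simp only [SimpleGraph.fromEdgeSet_adj]
    constructor
    · rintro ⟨⟨e, he, hee⟩, -⟩
      simpa [hee] using he
    · intro h
      exact ⟨⟨⟨s(a, b), by simpa using h.ne⟩, by simpa using h, rfl⟩, h.ne⟩

theorem edgeSet_graphEquivEdgeFinset {n : ℕ} (S : Finset (⊤ : SimpleGraph (Fin n)).edgeSet) :
    (graphEquivEdgeFinset n S).edgeSet =
      (fun e : (⊤ : SimpleGraph (Fin n)).edgeSet => (e : Sym2 (Fin n))) '' (S : Set _) := by
  rw [graphEquivEdgeFinset, Equiv.coe_fn_mk, SimpleGraph.edgeSet_fromEdgeSet, sdiff_eq_left]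
  rw [Set.disjoint_left]
  rintro _ ⟨e, -, rfl⟩
  exact SimpleGraph.not_isDiag_of_mem_edgeSet _ e.2

end Triangles

/-! ### The two forms of the theorem -/

theorem exists_triangleFree_sum_edgeDisjointGraphs_lt_one {n : ℕ} (hn : 0 < n)
    (a : SimpleGraph (Fin n) → ℝ) (ha : ∀ H, 0 ≤ a H)
    (hsum : ∑ H : SimpleGraph (Fin n),
      a H * Real.exp (-(1 / 100) * (H.edgeSet.ncard : ℝ) / √(n : ℝ)) < 1 / 2) :
    ∃ G : SimpleGraph (Fin n), G.CliqueFree 3 ∧ ∑ H ∈ edgeDisjointGraphs G, a H < 1 := by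
  classical
  have hcard : ∀ S, (graphEquivEdgeFinset n S).edgeSet.ncard = S.card := fun S => by
    rw [edgeSet_graphEquivEdgeFinset, Set.ncard_image_of_injective _ Subtype.val_injective,
      Set.ncard_coe_finset]
  rw [← (graphEquivEdgeFinset n).sum_comp] at hsum
  simp_rw [hcard] at hsum
  obtain ⟨S, hS, h⟩ := exists_triangleFree_sum_disjoint_lt_one hn
    (fun S => a (graphEquivEdgeFinset n S)) (fun S => ha _) hsum.le
  refine ⟨graphEquivEdgeFinset n S, hS, ?_⟩
  rw [edgeDisjointGraphs, Finset.sum_filter, ← (graphEquivEdgeFinset n).sum_comp]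
  rw [Finset.sum_filter] at h
  refine (Finset.sum_congr rfl fun H _ => ?_).trans_lt h
  refine if_congr ?_ rfl rfl
  rw [edgeSet_graphEquivEdgeFinset, edgeSet_graphEquivEdgeFinset,
    ← Set.image_inter Subtype.val_injective, Set.image_eq_empty, ← Set.disjoint_iff_inter_eq_empty,
    Finset.disjoint_coe]

/-- Complementation turns a certificate `g` into weights `b H = g Hᶜ`, because `S ⊆ Hᶜ` means that
`S` and `H` are disjoint. A small threshold would then contradict the existence of `S`. -/
theorem le_fracExpThreshold_triangleFreeFamily {n : ℕ} (hn : 3 ≤ n) :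
    (1 / 200) / √(n : ℝ) ≤ fracExpThreshold (triangleFreeFamily n) := by
  obtain ⟨⟨⟨hq0, hq1⟩, g, hg0, hg1, hg2⟩, -⟩ :=
    isLeast_fracExpThreshold _ (univ_notMem_triangleFreeFamily hn)
  set q := fracExpThreshold (triangleFreeFamily n)
  by_contra! hlt
  have hsq : 1 ≤ √(n : ℝ) := Real.one_le_sqrt.2 (by exact_mod_cast (by omega : 1 ≤ n))
  set x : ℝ := (1 / 100) / √(n : ℝ) with hx
  have hx0 : 0 < x := by positivity
  have hx1 : x ≤ 1 := by
    rw [hx, div_le_one (by positivity)]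
    linarith
  have hqx : q < x / 2 := hlt.trans_eq (by rw [hx]; ring)
  -- For `0 < x ≤ 1`, `exp (-x) ≤ 1 / (1 + x) ≤ 1 - x / 2`; hence the constant `1 / 200`, half of `1
  -- / 100`.
  have hexp : Real.exp (-x) ≤ 1 - q := by
    have h1 : Real.exp (-x) ≤ (1 + x)⁻¹ := by
      rw [Real.exp_neg]
      exact inv_anti₀ (by positivity) (by linarith [Real.add_one_le_exp x])
    have h2 : (1 + x)⁻¹ ≤ 1 - x / 2 := by
      rw [inv_le_iff_one_le_mul₀ (by positivity)]
      nlinarith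
    linarith
  obtain ⟨S, hS, h⟩ := exists_triangleFree_sum_disjoint_lt_one (by omega : 0 < n)
    (fun H => g Hᶜ) (fun H => hg0 _) (by
      refine le_trans ?_ hg2
      rw [← Equiv.sum_comp (compl_involutive (α := Finset (⊤ : SimpleGraph (Fin n)).edgeSet)).toPerm fun T => g T * (1 - q) ^ (Tᶜ).card]
      refine Finset.sum_le_sum fun H _ => mul_le_mul_of_nonneg_left ?_ (hg0 _)
      rw [Function.Involutive.coe_toPerm, compl_compl]
      calc Real.exp (-(1 / 100) * H.card / √(n : ℝ)) = Real.exp (-x) ^ H.card := by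
            rw [← Real.exp_nat_mul, hx]
            congr 1
            ring
        _ ≤ _ := by gcongr)
  refine absurd (hg1 S hS) (not_le.2 (lt_of_eq_of_lt ?_ h))
  rw [Finset.sum_filter, Finset.sum_filter, ← Equiv.sum_comp (compl_involutive (α := Finset (⊤ : SimpleGraph (Fin n)).edgeSet)).toPerm]
  refine Finset.sum_congr rfl fun H _ => ?_
  simp only [Function.Involutive.coe_toPerm]
  exact if_congr Finset.subset_compl_iff_disjoint_right rfl rfl

theorem mainTheorem3 :
    (∃ δ : ℝ, 0 < δ ∧ ∀ᶠ n : ℕ in Filter.atTop,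
      ∀ a : SimpleGraph (Fin n) → ℝ, (∀ H, 0 ≤ a H) →
        ∑ H : SimpleGraph (Fin n),
            a H * Real.exp (-δ * (H.edgeSet.ncard : ℝ) / Real.sqrt (n : ℝ)) < 1 / 2 →
        ∃ G : SimpleGraph (Fin n), G.CliqueFree 3 ∧ ∑ H ∈ edgeDisjointGraphs G, a H < 1) ∧
    (∃ c : ℝ, 0 < c ∧ ∀ᶠ n : ℕ in Filter.atTop,
      c / Real.sqrt (n : ℝ) ≤ fracExpThreshold (triangleFreeFamily n)) := by
  refine ⟨⟨1 / 100, by norm_num, ?_⟩, ⟨1 / 200, by norm_num, ?_⟩⟩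
  · filter_upwards [Filter.eventually_gt_atTop 0] with n hn a ha hsum
    exact exists_triangleFree_sum_edgeDisjointGraphs_lt_one hn a ha hsum
  · filter_upwards [Filter.eventually_ge_atTop 3] with n hn
    exact le_fracExpThreshold_triangleFreeFamily hn
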